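/- Let $m\ge 0$ be an integer, $\beta>0$ and $0<c<1$ real numbers. Write $(a)_k=a(a+1)\cdots(a+k-1)$, and let $M_k(x;\beta,c)=(\beta)_k\,{}_2F_1(-k,-x;\beta;1-1/c)$ be the Meixner polynomials. For nonnegative integers $n_0$ and $\boldsymbol n=(n_1,\dots,n_m)$ put $$B^{(\beta)}(n_0,\boldsymbol n)=(-1)^{n_1+\cdots+n_m}c^{-n_0}(1-c)^{\beta+n_0}\sum_{x=0}^\infty x(x-1)\cdots(x-n_0+1)\,\frac{c^x(\beta)_x}{x!}\prod_{j=1}^m M_{n_j}(x;\beta,c).$$ All these series converge absolutely. The numbers $B^{(\beta)}(n_0,\boldsymbol n)$ have the generating function $$\sum_{n_0,\dots,n_m\ge 0}B^{(\beta)}(n_0,\boldsymbol n)\prod_{j=0}^m\frac{x_j^{n_j}}{n_j!} =\Bigl[1-\sum_{k=2}^m\frac{1-c^{1-k}}{c(1-c^{-1})}\,e_k(x_1,\dots,x_m)-x_0\prod_{j=1}^m(1+x_j/c)\Bigr]^{-\beta},$$ an identity of formal power series in $x_0,\dots,x_m$, where $e_k$ is the $k$-th elementary symmetric polynomial and, for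 a series $F$ with constant term $1$, $F^{-\beta}=\sum_{k\ge0}\binom{-\beta}{k}(F-1)^k$. Moreover, let $S_0,S_1,\dots,S_m$ be disjoint sets ("boxes") with $|S_j|=n_j$, and let $\mathfrak S^*(\boldsymbol n)$ be the set of permutations $\pi$ of $S_0\cup S_1\cup\cdots\cup S_m$ with $\pi(S_j)\cap S_j=\emptyset$ for $1\le j\le m$ (elements of $S_0$ are not restricted). Then $$B^{(\beta)}(n_0,\boldsymbol n)=\sum_{\pi\in\mathfrak S^*(\boldsymbol n)}\beta^{\operatorname{cyc}(\pi)}c^{-\operatorname{exc}(\pi)},$$ where $\operatorname{cyc}(\pi)$ is the number of cycles of $\pi$ (fixed points included) and $\operatorname{exc}(\pi)$ is the number of box-excedances of $\pi$, that is, of elements $a\in S_i$ with $\pi(a)\in S_j$ and $j>i$. -/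

import Mathlib

open scoped BigOperators

namespace Meixner

noncomputable section

/-- The Meixner polynomial `M_k(x; β, c) = (β)_k ₂F₁(-k, -x; β; 1 - 1/c)`, where `(β)_k` is the
rising factorial. -/
def meixnerPoly (k : ℕ) (x β c : ℝ) : ℝ :=
  (ascPochhammer ℝ k).eval β * ordinaryHypergeometric (-(k : ℝ)) (-x) β (1 - 1 / c)

/-- The summand `x(x-1)⋯(x-n₀+1) · c^x (β)_x / x! · ∏_j M_{n_j}(x; β, c)` at the integer `x`. -/
def summand {m : ℕ} (β c : ℝ) (n₀ : ℕ) (n : Fin m → ℕ) (x : ℕ) : ℝ :=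
  (descPochhammer ℝ n₀).eval (x : ℝ) * (c ^ x * (ascPochhammer ℝ x).eval β / (x.factorial : ℝ)) *
    ∏ j, meixnerPoly (n j) (x : ℝ) β c

/-- The generalized linearization coefficient `B^{(β)}(n₀, n)`. -/
def B {m : ℕ} (β c : ℝ) (n₀ : ℕ) (n : Fin m → ℕ) : ℝ :=
  (-1) ^ (∑ j, n j) * (c ^ n₀)⁻¹ * (1 - c) ^ (β + (n₀ : ℝ)) * ∑' x : ℕ, summand β c n₀ n x

/-- The exponential generating function
`∑ B^{(β)}(n₀, n) ∏_{j=0}^m x_j^{n_j} / n_j!` as a formal power series in `x_0, …, x_m`. -/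
def genFun (m : ℕ) (β c : ℝ) : MvPowerSeries (Fin (m + 1)) ℝ :=
  fun d => B β c (d 0) (fun j : Fin m => d j.succ) / ∏ j : Fin (m + 1), ((d j).factorial : ℝ)

/-- The elementary symmetric polynomial `e_k(x_1, …, x_m)`, in the variables `x_0, …, x_m`. -/
def elemSymm (m k : ℕ) : MvPolynomial (Fin (m + 1)) ℝ :=
  MvPolynomial.rename Fin.succ (MvPolynomial.esymm (Fin m) ℝ k)

/-- `1 - ∑_{k=2}^m (1 - c^{1-k}) / (c (1 - c⁻¹)) e_k(x_1, …, x_m) - x_0 ∏_{j=1}^m (1 + x_j / c)`. -/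
def bracket (m : ℕ) (c : ℝ) : MvPolynomial (Fin (m + 1)) ℝ :=
  1 - ∑ k ∈ Finset.Icc 2 m,
        MvPolynomial.C ((1 - c ^ (1 - (k : ℤ))) / (c * (1 - c⁻¹))) * elemSymm m k
    - MvPolynomial.X 0 * ∏ j : Fin m, (1 + MvPolynomial.C (1 / c) * MvPolynomial.X j.succ)

/-- The power `F ^ r = ∑_k (r choose k) (F - 1)^k` of a formal power series `F` with constant
coefficient `1`: the binomial series `(1 + T)^r` with `T = F - 1` substituted. -/
def seriesPow {σ : Type*} (F : MvPowerSeries σ ℝ) (r : ℝ) : MvPowerSeries σ ℝ :=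
  (PowerSeries.binomialSeries ℝ r).subst (F - 1)

/-- The disjoint union `S_0 ∪ S_1 ∪ ⋯ ∪ S_m` of boxes, with `n₀` objects in box `0` and `n_j`
objects in box `j` for `1 ≤ j ≤ m`. The first component of an object is the index of its box. -/
abbrev Obj {m : ℕ} (n₀ : ℕ) (n : Fin m → ℕ) : Type :=
  Σ j : Fin (m + 1), Fin ((Fin.cons n₀ n : Fin (m + 1) → ℕ) j)

/-- The permutations of `S_0 ∪ ⋯ ∪ S_m` that leave no object of a box `j ≥ 1` in its box; the
objects of box `0` are not restricted. -/
def starPerms {m : ℕ} (n₀ : ℕ) (n : Fin m → ℕ) : Finset (Equiv.Perm (Obj n₀ n)) :=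
  Finset.univ.filter fun π => ∀ a : Obj n₀ n, a.1 ≠ 0 → (π a).1 ≠ a.1

/-- The number of cycles of a permutation, fixed points included. -/
def cyc {α : Type*} [Fintype α] [DecidableEq α] (π : Equiv.Perm α) : ℕ :=
  π.cycleType.card + (Finset.univ.filter fun a => π a = a).card

/-- The number of box-excedances: objects that are sent to a box with a larger index. -/
def exc {m : ℕ} {n₀ : ℕ} {n : Fin m → ℕ} (π : Equiv.Perm (Obj n₀ n)) : ℕ :=
  (Finset.univ.filter fun a : Obj n₀ n => a.1 < (π a).1).card

end

end Meixner

/-! The generating function comes from summing in $x$ last. For a natural number $x$ the Meixner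
polynomials satisfy $\sum_k (-1)^k M_k(x)t^k/k! = (1+t)^{-\beta}\bigl((1+t/c)/(1+t)\bigr)^x$
(`coeff_binomialSeries_mul_ratioSeries_pow`), so the generating function of the summands is the
weight $c^x(\beta)_x/x!$ times $A\,W^x$, where $A=\prod_{j\ge1}(1+x_j)^{-\beta}$ and $W$ has
constant term $1$. Expanding $W^x=\sum_k\binom xk(W-1)^k$ leaves finitely many $k$ in each
coefficient, and the factorial moments of the weight (`hasSum_weight_mul_choose`) turn the sum into
$(1-c)^{-\beta}A\,\bigl(1-\tfrac{c}{1-c}(W-1)\bigr)^{-\beta}$. This gives convergence as well, and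
the bracket is exactly $\prod_{j\ge1}(1+x_j)\cdot\bigl(1-\tfrac c{1-c}(W-1)\bigr)$ (`coe_bracket`).

For the permutations, both sides are polynomials in $\beta$ once the generating function is known,
so $\beta=-N$ suffices. There $(-N)^{\mathrm{cyc}}$ is $(-1)^{\mathrm{cyc}}$ times the number of
$N$-colorings constant on cycles, and $(-1)^{\mathrm{cyc}}$ is the sign of $\pi$ up to a global
sign. The permutation sum thus becomes a sum over colorings of products of determinants, one per
color class. The Leibniz rule splits the derivatives at $0$ of the $N$-th power of the bracket over
the same colorings (`derivAtZero_prod`). What remains is the case of one color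
(`derivAtZero_bracket`): a derivative of the bracket is a signed determinant of a matrix constant
above and below the diagonal, which has a closed form (`det_const_off_diagonal`). -/

namespace Meixner

/-! ### Real powers of formal power series -/

open MvPowerSeries in
/-- Only finitely many powers of `a` contribute to a coefficient of `g * f(a)`. -/
theorem coeff_mul_subst {σ : Type*} {a : MvPowerSeries σ ℝ} (ha : constantCoeff a = 0)
    (f : PowerSeries ℝ) (g : MvPowerSeries σ ℝ) (d : σ →₀ ℕ) :
    coeff d (g * f.subst a) =
      ∑ k ∈ Finset.range (d.degree + 1), PowerSeries.coeff k f * coeff d (g * a ^ k) := by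
  have hs : PowerSeries.HasSubst a := PowerSeries.HasSubst.of_constantCoeff_zero ha
  set n := d.degree + 1 with hn
  have hf := PowerSeries.eq_X_pow_mul_shift_add_trunc n f
  set h : PowerSeries ℝ := PowerSeries.mk fun i => PowerSeries.coeff (i + n) f
  have h1 : f.subst a = a ^ n * h.subst a + Polynomial.aeval a (PowerSeries.trunc n f) := by
    conv_lhs => rw [hf]
    rw [PowerSeries.subst_add hs, PowerSeries.subst_mul hs, PowerSeries.subst_pow hs,
      PowerSeries.subst_X hs, PowerSeries.subst_coe hs]
  -- The order of `a ^ n` is at least `n = d.degree + 1`, so the tail cannot reach the monomial `d`.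
  have h2 : coeff d (g * (a ^ n * h.subst a)) = 0 := by
    apply coeff_of_lt_order
    have h3 : (n : ℕ∞) ≤ (a ^ n).order := le_order_pow_of_constantCoeff_eq_zero n ha
    calc (d.degree : ℕ∞) < n := by rw [hn]; exact_mod_cast Nat.lt_succ_self _
      _ ≤ (a ^ n).order := h3
      _ ≤ (a ^ n).order + (g * h.subst a).order := le_self_add
      _ ≤ (a ^ n * (g * h.subst a)).order := le_order_mul
      _ = _ := by congr 1; ring
  rw [h1, mul_add, map_add, h2, zero_add,
    Polynomial.aeval_eq_sum_range' (PowerSeries.natDegree_trunc_lt f _), Finset.mul_sum, map_sum]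
  refine Finset.sum_congr rfl fun k hk => ?_
  rw [mul_smul_comm, map_smul, PowerSeries.coeff_trunc, if_pos (Finset.mem_range.mp hk),
    smul_eq_mul]

open MvPowerSeries in
theorem coeff_mul_seriesPow {σ : Type*} {F : MvPowerSeries σ ℝ} (hF : constantCoeff F = 1)
    (r : ℝ) (g : MvPowerSeries σ ℝ) (d : σ →₀ ℕ) :
    coeff d (g * seriesPow F r) =
      ∑ k ∈ Finset.range (d.degree + 1), Ring.choose r k * coeff d (g * (F - 1) ^ k) := by
  rw [seriesPow, coeff_mul_subst (by simp [hF])]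
  simp [PowerSeries.binomialSeries_coeff]

open MvPowerSeries in
theorem seriesPow_natCast {σ : Type*} {F : MvPowerSeries σ ℝ} (hF : constantCoeff F = 1) (N : ℕ) :
    seriesPow F (N : ℝ) = F ^ N := by
  have hs : PowerSeries.HasSubst (F - 1) :=
    PowerSeries.HasSubst.of_constantCoeff_zero (by simp [hF])
  rw [seriesPow, PowerSeries.binomialSeries_nat, PowerSeries.subst_pow hs,
    PowerSeries.subst_add hs, PowerSeries.subst_X hs, ← PowerSeries.coe_substAlgHom hs, map_one,
    add_sub_cancel]

open Polynomial in
/-- `(r choose k)` is a polynomial in `r`. -/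
theorem exists_eval_eq_choose (k : ℕ) : ∃ p : ℝ[X], ∀ r, p.eval r = Ring.choose r k := by
  refine ⟨C ((k.factorial : ℝ)⁻¹) * (descPochhammer ℤ k).map (Int.castRingHom ℝ), fun r => ?_⟩
  rw [Ring.choose_eq_smul, eval_mul, eval_C, eval_map, ← Polynomial.eval₂_smulOneHom_eq_smeval,
    smul_eq_mul]
  congr 2
  exact RingHom.ext_int _ _

open MvPowerSeries in
/-- A family of power series all of whose coefficients are polynomials in the parameter. -/
def IsPolyFamily {σ : Type*} (Φ : ℝ → MvPowerSeries σ ℝ) : Prop :=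
  ∀ d, ∃ p : Polynomial ℝ, ∀ r, p.eval r = coeff d (Φ r)

theorem polynomial_eq_of_eval_natCast {p q : Polynomial ℝ}
    (h : ∀ N : ℕ, p.eval (N : ℝ) = q.eval (N : ℝ)) : p = q := by
  refine Polynomial.eq_of_infinite_eval_eq p q (Set.Infinite.mono ?_
    (Set.infinite_range_of_injective (Nat.cast_injective (R := ℝ))))
  rintro _ ⟨N, rfl⟩
  exact h N

/-- Coefficientwise, two polynomials that agree at all natural numbers coincide. This reduces
identities between real powers to ordinary powers. -/
theorem IsPolyFamily.eq_of_natCast {σ : Type*} {Φ Ψ : ℝ → MvPowerSeries σ ℝ}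
    (hΦ : IsPolyFamily Φ) (hΨ : IsPolyFamily Ψ) (h : ∀ N : ℕ, Φ N = Ψ N) (r : ℝ) : Φ r = Ψ r := by
  ext d
  obtain ⟨p, hp⟩ := hΦ d
  obtain ⟨q, hq⟩ := hΨ d
  rw [← hp, ← hq, polynomial_eq_of_eval_natCast (p := p) (q := q) fun N => by rw [hp, hq, h N]]

theorem IsPolyFamily.mul {σ : Type*} {Φ Ψ : ℝ → MvPowerSeries σ ℝ}
    (hΦ : IsPolyFamily Φ) (hΨ : IsPolyFamily Ψ) : IsPolyFamily fun r => Φ r * Ψ r := by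
  classical
  intro d
  choose p hp using hΦ
  choose q hq using hΨ
  refine ⟨∑ e ∈ Finset.HasAntidiagonal.antidiagonal d, p e.1 * q e.2, fun r => ?_⟩
  simp [Polynomial.eval_finsetSum, MvPowerSeries.coeff_mul, hp, hq]

theorem isPolyFamily_seriesPow {σ : Type*} {F : MvPowerSeries σ ℝ}
    (hF : MvPowerSeries.constantCoeff F = 1) : IsPolyFamily (seriesPow F) := by
  intro d
  choose p hp using exists_eval_eq_choose
  refine ⟨∑ k ∈ Finset.range (d.degree + 1),
    p k * Polynomial.C (MvPowerSeries.coeff d ((F - 1) ^ k)), fun r => ?_⟩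
  have := coeff_mul_seriesPow hF r 1 d
  simp only [one_mul] at this
  simp [this, Polynomial.eval_finsetSum, hp]

theorem seriesPow_mul {σ : Type*} {F G : MvPowerSeries σ ℝ}
    (hF : MvPowerSeries.constantCoeff F = 1) (hG : MvPowerSeries.constantCoeff G = 1) (r : ℝ) :
    seriesPow (F * G) r = seriesPow F r * seriesPow G r := by
  have hFG : MvPowerSeries.constantCoeff (F * G) = 1 := by simp [hF, hG]
  refine (isPolyFamily_seriesPow hFG).eq_of_natCast
    ((isPolyFamily_seriesPow hF).mul (isPolyFamily_seriesPow hG)) (fun N => ?_) r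
  rw [seriesPow_natCast hF, seriesPow_natCast hG, seriesPow_natCast hFG, mul_pow]

theorem seriesPow_one {σ : Type*} (r : ℝ) : seriesPow (1 : MvPowerSeries σ ℝ) r = 1 := by
  classical
  ext d
  have := coeff_mul_seriesPow (F := (1 : MvPowerSeries σ ℝ)) (by simp) r 1 d
  rw [one_mul] at this
  rw [this, Finset.sum_eq_single 0]
  · simp
  · intro k _ hk
    simp [hk]
  · simp

theorem seriesPow_prod {σ ι : Type*} (s : Finset ι) {F : ι → MvPowerSeries σ ℝ}
    (hF : ∀ i, MvPowerSeries.constantCoeff (F i) = 1) (r : ℝ) :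
    seriesPow (∏ i ∈ s, F i) r = ∏ i ∈ s, seriesPow (F i) r := by
  classical
  induction s using Finset.induction_on with
  | empty => simp [seriesPow_one]
  | insert i s hi ih =>
    rw [Finset.prod_insert hi, Finset.prod_insert hi, seriesPow_mul (hF i) (by simp [map_prod, hF]),
      ih]

/-- The coefficients of a product of power series in distinct variables. -/
theorem coeff_prod_subst_X {σ : Type*} [Fintype σ] (f : σ → PowerSeries ℝ) (d : σ →₀ ℕ) :
    MvPowerSeries.coeff d (∏ i, (f i).subst (MvPowerSeries.X i : MvPowerSeries σ ℝ)) =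
      ∏ i, PowerSeries.coeff (d i) (f i) := by
  classical
  rw [MvPowerSeries.coeff_prod]
  have hmem : Finsupp.equivFunOnFinite.symm (fun i => Finsupp.single i (d i)) ∈
      Finset.finsuppAntidiag Finset.univ d := by
    rw [Finset.mem_finsuppAntidiag]
    refine ⟨?_, Finset.subset_univ _⟩
    ext j
    simp
  -- The `i`-th factor involves only the variable `i`, so a single splitting of `d` contributes.
  rw [Finset.sum_eq_single_of_mem _ hmem]
  · refine Finset.prod_congr rfl fun i _ => ?_
    rw [PowerSeries.coeff_subst_single]
    simp
  · intro l hl hne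
    rw [Finset.mem_finsuppAntidiag] at hl
    by_contra h
    apply hne
    have h1 : ∀ i, l i = Finsupp.single i (l i i) := by
      intro i
      by_contra hi
      exact h (Finset.prod_eq_zero (Finset.mem_univ i) (by
        rw [PowerSeries.coeff_subst_single, if_neg hi]))
    ext i j
    have h2 : d i = l i i := by
      rw [← hl.1, Finsupp.finsetSum_apply, Finset.sum_eq_single i]
      · intro k _ hk
        rw [h1 k, Finsupp.single_apply, if_neg hk]
      · simp
    simp only [Finsupp.equivFunOnFinite_symm_apply_apply, h2]
    rw [h1 i]
    simp

end Meixner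

/-! ### Moments of the weight and the Meixner generating function -/

namespace Meixner

theorem ascPochhammer_eval_add (b : ℝ) (j i : ℕ) :
    (ascPochhammer ℝ (j + i)).eval b =
      (ascPochhammer ℝ j).eval b * (ascPochhammer ℝ i).eval (b + j) := by
  rw [← ascPochhammer_mul]
  simp [Polynomial.eval_comp]

theorem multichoose_eq_div (b : ℝ) (n : ℕ) :
    Ring.multichoose b n = (ascPochhammer ℝ n).eval b / (n.factorial : ℝ) := by
  have h := Ring.factorial_nsmul_multichoose_eq_ascPochhammer b n
  rw [Polynomial.ascPochhammer_smeval_eq_eval, nsmul_eq_mul] at h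
  rw [← h]
  field_simp

theorem choose_neg_eq_div (b : ℝ) (n : ℕ) :
    Ring.choose (-b) n = (-1) ^ n * ((ascPochhammer ℝ n).eval b / (n.factorial : ℝ)) := by
  rw [Ring.choose_neg', multichoose_eq_div, Int.negOnePow_def, zpow_natCast, Units.smul_def]
  simp

theorem descPochhammer_eval_natCast (x k : ℕ) :
    (descPochhammer ℝ k).eval (x : ℝ) = k.factorial * (x.choose k : ℝ) := by
  rw [descPochhammer_eval_eq_descFactorial, Nat.descFactorial_eq_factorial_mul_choose]
  push_cast
  ring

/-- The weight `c ^ x (β)_x / x!` of the Meixner polynomials. -/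
noncomputable def weight (β c : ℝ) (x : ℕ) : ℝ :=
  c ^ x * (ascPochhammer ℝ x).eval β / (x.factorial : ℝ)

theorem hasSum_weight (β : ℝ) {c : ℝ} (hc0 : 0 < c) (hc1 : c < 1) :
    HasSum (weight β c) ((1 - c) ^ (-β)) := by
  have h := (Real.one_div_one_sub_rpow_hasFPowerSeriesOnBall_zero β).hasSum (y := c) (by
    simp only [Metric.mem_eball, edist_zero_right]
    rw [Real.enorm_eq_ofReal hc0.le]
    exact ENNReal.ofReal_lt_one.mpr hc1)
  rw [zero_add, one_div, ← Real.rpow_neg (by linarith)] at h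
  refine (congrArg (HasSum · _) (funext fun x => ?_)).mpr h
  rw [FormalMultilinearSeries.ofScalars_apply_eq, ← Ring.multichoose_eq, multichoose_eq_div,
    smul_eq_mul, weight]
  ring

/-- The factorial moments of the weight. -/
theorem hasSum_weight_mul_choose {β c : ℝ} (hc0 : 0 < c) (hc1 : c < 1) (k : ℕ) :
    HasSum (fun x => weight β c x * (x.choose k : ℝ))
      ((ascPochhammer ℝ k).eval β / (k.factorial : ℝ) * c ^ k * (1 - c) ^ (-β - k)) := by
  -- The terms with `x < k` vanish; after the shift by `k` the weight for `β` becomes a multiple of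
  -- the weight for `β + k`.
  rw [← hasSum_nat_add_iff' k]
  have h0 : ∑ i ∈ Finset.range k, weight β c i * (i.choose k : ℝ) = 0 :=
    Finset.sum_eq_zero fun i hi => by
      rw [Nat.choose_eq_zero_of_lt (Finset.mem_range.mp hi)]; simp
  rw [h0, sub_zero]
  have h := (hasSum_weight (β + k) hc0 hc1).mul_left
    ((ascPochhammer ℝ k).eval β / (k.factorial : ℝ) * c ^ k)
  rw [show -(β + k) = -β - k by ring] at h
  refine (congrArg (HasSum · _) (funext fun y => ?_)).mpr h
  have hch : ((y + k).choose k : ℝ) = ((y + k).factorial : ℝ) / (k.factorial * y.factorial) := by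
    rw [add_comm y k, Nat.cast_add_choose]
  rw [hch, weight, weight, add_comm y k, ascPochhammer_eval_add, pow_add]
  field_simp

/-- The series `(1 + X/c) / (1 + X)`. -/
noncomputable def ratioSeries (c : ℝ) : PowerSeries ℝ :=
  1 + PowerSeries.C (1 / c - 1) * (PowerSeries.X * PowerSeries.binomialSeries ℝ (-1 : ℝ))

theorem ratioSeries_mul (c : ℝ) :
    ratioSeries c * (1 + PowerSeries.X) = 1 + PowerSeries.C (1 / c) * PowerSeries.X := by
  have h : PowerSeries.binomialSeries ℝ (-1 : ℝ) * (1 + PowerSeries.X) = 1 := by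
    have h1 := PowerSeries.binomialSeries_nat (R := ℝ) (A := ℝ) 1
    rw [pow_one] at h1
    rw [← h1, ← PowerSeries.binomialSeries_add]
    simp
  have h2 : PowerSeries.C (1 / c - 1) = (PowerSeries.C (1 / c) - 1 : PowerSeries ℝ) := by simp
  rw [ratioSeries, h2]
  linear_combination (PowerSeries.C (1 / c) - 1) * PowerSeries.X * h

theorem binomialSeries_neg_natCast (j : ℕ) :
    PowerSeries.binomialSeries ℝ (-(j : ℝ)) = PowerSeries.binomialSeries ℝ (-1 : ℝ) ^ j := by
  induction j with
  | zero => simp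
  | succ j ih =>
    rw [pow_succ, ← ih, ← PowerSeries.binomialSeries_add]
    congr 1
    push_cast
    ring

/-- The hypergeometric series terminates because $(-k)_j=0$ for $j>k$. Positivity of `β` allows
$(\beta)_j$ to be cancelled against $(\beta)_k=(\beta)_j(\beta+j)_{k-j}$. -/
theorem meixnerPoly_natCast {β : ℝ} (hβ : 0 < β) (c : ℝ) (k x : ℕ) :
    meixnerPoly k (x : ℝ) β c = k.factorial * ∑ j ∈ Finset.range (k + 1),
      (x.choose j : ℝ) * (1 - 1 / c) ^ j *
        ((ascPochhammer ℝ (k - j)).eval (β + j) / ((k - j).factorial : ℝ)) := by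
  rw [meixnerPoly, ordinaryHypergeometric_eq_tsum]
  beta_reduce
  rw [tsum_eq_sum (s := Finset.range (k + 1)),
    Finset.mul_sum, Finset.mul_sum]
  · refine Finset.sum_congr rfl fun j hj => ?_
    have hjk : j ≤ k := Nat.lt_succ_iff.mp (Finset.mem_range.mp hj)
    have hpos : (ascPochhammer ℝ j).eval β ≠ 0 := (ascPochhammer_pos j β hβ).ne'
    have hsplit : (ascPochhammer ℝ k).eval β =
        (ascPochhammer ℝ j).eval β * (ascPochhammer ℝ (k - j)).eval (β + j) := by
      rw [← ascPochhammer_eval_add, Nat.add_sub_cancel' hjk]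
    rw [hsplit, ascPochhammer_eval_neg_eq_descPochhammer, ascPochhammer_eval_neg_eq_descPochhammer,
      descPochhammer_eval_natCast, descPochhammer_eval_natCast, Nat.cast_choose ℝ hjk]
    have h1 : ((-1 : ℝ) ^ j) * (-1) ^ j = 1 := by rw [← mul_pow]; simp
    simp only [smul_eq_mul]
    field_simp
    linear_combination ((ascPochhammer ℝ (k - j)).eval (β + j) * (x.choose j : ℝ) *
      (1 - 1 / c) ^ j) * h1
  · intro j hj
    have hjk : k < j := by simpa using hj
    rw [ascPochhammer_eval_neg_coe_nat_of_lt hjk]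
    simp

/-- The generating function of the Meixner polynomials at a natural number. -/
theorem coeff_binomialSeries_mul_ratioSeries_pow {β : ℝ} (hβ : 0 < β) (c : ℝ) (k x : ℕ) :
    PowerSeries.coeff k (PowerSeries.binomialSeries ℝ (-β) * ratioSeries c ^ x) =
      (-1) ^ k * meixnerPoly k (x : ℝ) β c / k.factorial := by
  -- Binomial expansion of $\bigl(1+(1/c-1)X(1+X)^{-1}\bigr)^x$, with the powers of $1+X$ collected.
  have hexp : PowerSeries.binomialSeries ℝ (-β) * ratioSeries c ^ x =
      ∑ j ∈ Finset.range (x + 1), PowerSeries.C ((x.choose j : ℝ) * (1 / c - 1) ^ j) *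
        (PowerSeries.X ^ j * PowerSeries.binomialSeries ℝ (-(β + j))) := by
    rw [ratioSeries, add_comm, add_pow, Finset.mul_sum]
    refine Finset.sum_congr rfl fun j _ => ?_
    rw [neg_add, PowerSeries.binomialSeries_add, binomialSeries_neg_natCast, mul_pow, mul_pow,
      map_mul, map_pow, map_natCast]
    ring
  have hterm : ∀ j, PowerSeries.coeff k (PowerSeries.C ((x.choose j : ℝ) * (1 / c - 1) ^ j) *
      (PowerSeries.X ^ j * PowerSeries.binomialSeries ℝ (-(β + j)))) =
      if j ≤ k then (-1) ^ k * ((x.choose j : ℝ) * (1 - 1 / c) ^ j *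
        ((ascPochhammer ℝ (k - j)).eval (β + j) / ((k - j).factorial : ℝ))) else 0 := by
    intro j
    rw [PowerSeries.coeff_C_mul, PowerSeries.coeff_X_pow_mul']
    split_ifs with hjk
    · rw [PowerSeries.binomialSeries_coeff, choose_neg_eq_div, smul_eq_mul, mul_one]
      have h1 : (-1 : ℝ) ^ k = (-1) ^ j * (-1) ^ (k - j) := by
        rw [← pow_add, Nat.add_sub_cancel' hjk]
      have h2 : (1 / c - 1) ^ j = (-1) ^ j * (1 - 1 / c) ^ j := by
        rw [← mul_pow]; congr 1; ring
      rw [h1, h2]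
      ring
    · simp
  rw [hexp, map_sum, Finset.sum_congr rfl fun j _ => hterm j, meixnerPoly_natCast hβ,
    mul_left_comm, mul_div_cancel_left₀ _ (by positivity), Finset.mul_sum]
  set T : ℕ → ℝ := fun j => (-1) ^ k * ((x.choose j : ℝ) * (1 - 1 / c) ^ j *
    ((ascPochhammer ℝ (k - j)).eval (β + j) / ((k - j).factorial : ℝ))) with hT
  -- The terms vanish for `j > x` and for `j > k`; both ranges are compared with one that contains
  -- them.
  calc ∑ j ∈ Finset.range (x + 1), (if j ≤ k then T j else 0)
      = ∑ j ∈ Finset.range (x + k + 1), (if j ≤ k then T j else 0) := by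
        refine Finset.sum_subset (Finset.range_subset_range.mpr (by omega)) fun j _ hj => ?_
        have : x < j := by simpa using hj
        simp [hT, Nat.choose_eq_zero_of_lt this]
    _ = ∑ j ∈ Finset.range (k + 1), (if j ≤ k then T j else 0) := by
        refine (Finset.sum_subset (Finset.range_subset_range.mpr (by omega)) fun j _ hj => ?_).symm
        have : k < j := by simpa using hj
        rw [if_neg (by omega)]
    _ = ∑ j ∈ Finset.range (k + 1), T j :=
        Finset.sum_congr rfl fun j hj => if_pos (Nat.lt_succ_iff.mp (Finset.mem_range.mp hj))

theorem coeff_one_add_C_mul_X_pow (a : ℝ) (n x : ℕ) :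
    PowerSeries.coeff n ((1 + PowerSeries.C a * PowerSeries.X) ^ x) = (x.choose n : ℝ) * a ^ n := by
  rw [add_comm, add_pow, map_sum]
  have h : ∀ j, PowerSeries.coeff n ((PowerSeries.C a * PowerSeries.X) ^ j * 1 ^ (x - j) *
      (x.choose j : PowerSeries ℝ)) = if n = j then (x.choose j : ℝ) * a ^ j else 0 := by
    intro j
    have : (PowerSeries.C a * PowerSeries.X) ^ j * 1 ^ (x - j) * (x.choose j : PowerSeries ℝ) =
        PowerSeries.C ((x.choose j : ℝ) * a ^ j) * PowerSeries.X ^ j := by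
      rw [map_mul, map_pow, map_natCast]; ring
    rw [this, PowerSeries.coeff_C_mul, PowerSeries.coeff_X_pow]
    simp
  rw [Finset.sum_congr rfl fun j _ => h j, Finset.sum_ite_eq]
  split_ifs with hn
  · rfl
  · rw [Nat.choose_eq_zero_of_lt (by simpa using hn)]; simp

end Meixner

/-! ### The bracket and the generating function -/

namespace Meixner

theorem elemSymm_eq (m k : ℕ) :
    elemSymm m k = ∑ t ∈ Finset.powersetCard k (Finset.univ : Finset (Fin m)),
      ∏ j ∈ t, MvPolynomial.X j.succ := by
  simp [elemSymm, MvPolynomial.esymm, map_sum, map_prod]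

theorem prod_one_add_C_mul_X (m : ℕ) (a : ℝ) :
    ∏ j : Fin m, (1 + MvPolynomial.C a * MvPolynomial.X j.succ :
        MvPolynomial (Fin (m + 1)) ℝ) =
      ∑ k ∈ Finset.range (m + 1), MvPolynomial.C (a ^ k) * elemSymm m k := by
  rw [Finset.prod_one_add, Finset.sum_powerset, Finset.card_univ, Fintype.card_fin]
  refine Finset.sum_congr rfl fun k _ => ?_
  rw [elemSymm_eq, Finset.mul_sum]
  refine Finset.sum_congr rfl fun t ht => ?_
  rw [Finset.prod_mul_distrib, Finset.prod_const, (Finset.mem_powersetCard.mp ht).2, map_pow]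

theorem sum_range_eq_sum_Icc_two {M : Type*} [AddCommMonoid M] (g : ℕ → M) (h1 : g 1 = 0) (m : ℕ) :
    ∑ k ∈ Finset.range (m + 1), g k = g 0 + ∑ k ∈ Finset.Icc 2 m, g k := by
  induction m with
  | zero => simp
  | succ m ih =>
    rw [Finset.sum_range_succ, ih]
    rcases m with _ | m
    · simp [h1]
    · rw [Finset.sum_Icc_succ_top (by omega : 2 ≤ m + 1 + 1), add_assoc]

/-- The bracket in the generating function as a difference of two products. -/
theorem C_mul_bracket (m : ℕ) {c : ℝ} (hc0 : c ≠ 0) (hc1 : c ≠ 1) :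
    MvPolynomial.C (1 - c) * bracket m c =
      ∏ j : Fin m, (1 + MvPolynomial.C 1 * MvPolynomial.X j.succ) -
        MvPolynomial.C c * ((1 + MvPolynomial.C ((1 - c) / c) * MvPolynomial.X 0) *
          ∏ j : Fin m, (1 + MvPolynomial.C (1 / c) * MvPolynomial.X j.succ)) := by
  have hc2 : c - 1 ≠ 0 := sub_ne_zero.mpr hc1
  set Q : MvPolynomial (Fin (m + 1)) ℝ :=
    ∏ j : Fin m, (1 + MvPolynomial.C (1 / c) * MvPolynomial.X j.succ) with hQ
  have key : (∏ j : Fin m, (1 + MvPolynomial.C 1 * MvPolynomial.X j.succ)) -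
      MvPolynomial.C c * Q = MvPolynomial.C (1 - c) - MvPolynomial.C (1 - c) *
        ∑ k ∈ Finset.Icc 2 m,
          MvPolynomial.C ((1 - c ^ (1 - (k : ℤ))) / (c * (1 - c⁻¹))) * elemSymm m k := by
    rw [hQ, prod_one_add_C_mul_X, prod_one_add_C_mul_X, Finset.mul_sum, ← Finset.sum_sub_distrib,
      sum_range_eq_sum_Icc_two]
    · rw [Finset.mul_sum, sub_eq_add_neg (MvPolynomial.C (1 - c)), ← Finset.sum_neg_distrib]
      congr 1
      · simp [elemSymm_eq]
      · refine Finset.sum_congr rfl fun k _ => ?_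
        have h : (1 : ℝ) ^ k - c * (1 / c) ^ k =
            -((1 - c) * ((1 - c ^ (1 - (k : ℤ))) / (c * (1 - c⁻¹)))) := by
          have h3 : c * (1 - c⁻¹) = c - 1 := by field_simp
          rw [h3, zpow_sub₀ hc0, zpow_one, zpow_natCast, div_pow, one_pow]
          field_simp
          ring
        rw [← mul_assoc, ← mul_assoc, ← sub_mul, ← map_mul, ← map_mul, ← map_sub, h, map_neg,
          neg_mul]
    -- The terms of degree one cancel since $1-c\cdot(1/c)=0$, which is why the sum in the bracket
    -- starts at $k=2$.
    · rw [← mul_assoc, ← sub_mul, ← map_mul, ← map_sub]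
      simp [hc0]
  have hC : (MvPolynomial.C c * MvPolynomial.C ((1 - c) / c) : MvPolynomial (Fin (m + 1)) ℝ) =
      MvPolynomial.C (1 - c) := by
    rw [← map_mul]; congr 1; field_simp
  rw [bracket, ← hQ]
  linear_combination -key + MvPolynomial.X 0 * Q * hC

open MvPowerSeries (coeff)

theorem hasSubst_X {m : ℕ} (i : Fin m) :
    PowerSeries.HasSubst (MvPowerSeries.X i : MvPowerSeries (Fin m) ℝ) :=
  PowerSeries.HasSubst.X i

/-- The factors `f_i` of the generating function that do not depend on the summation variable. -/
noncomputable def baseFactor (m : ℕ) (β : ℝ) : Fin (m + 1) → PowerSeries ℝ :=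
  Fin.cons 1 fun _ => PowerSeries.binomialSeries ℝ (-β)

/-- The factors `w_i` of the generating function that are raised to the summation variable. -/
noncomputable def powFactor (m : ℕ) (c : ℝ) : Fin (m + 1) → PowerSeries ℝ :=
  Fin.cons (1 + PowerSeries.C ((1 - c) / c) * PowerSeries.X) fun _ => ratioSeries c

noncomputable def baseSeries (m : ℕ) (β : ℝ) : MvPowerSeries (Fin (m + 1)) ℝ :=
  ∏ i, (baseFactor m β i).subst (MvPowerSeries.X i : MvPowerSeries (Fin (m + 1)) ℝ)

/-- This is $W=\bigl(1+\tfrac{1-c}{c}x_0\bigr)\prod_{j\ge1}\frac{1+x_j/c}{1+x_j}$. The scaling of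
$x_0$ absorbs the factor $c^{-n_0}(1-c)^{n_0}$ of `B`. -/
noncomputable def powSeries (m : ℕ) (c : ℝ) : MvPowerSeries (Fin (m + 1)) ℝ :=
  ∏ i, (powFactor m c i).subst (MvPowerSeries.X i : MvPowerSeries (Fin (m + 1)) ℝ)

/-- The generating function of the summands. -/
theorem coeff_baseSeries_mul_powSeries_pow {m : ℕ} {β : ℝ} (hβ : 0 < β) (c : ℝ) (x : ℕ)
    (d : Fin (m + 1) →₀ ℕ) :
    weight β c x * coeff d (baseSeries m β * powSeries m c ^ x) =
      (-1) ^ (∑ j : Fin m, d j.succ) * ((1 - c) / c) ^ (d 0) *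
        summand β c (d 0) (fun j : Fin m => d j.succ) x /
          ∏ i : Fin (m + 1), ((d i).factorial : ℝ) := by
  have h : baseSeries m β * powSeries m c ^ x = ∏ i, (baseFactor m β i * powFactor m c i ^ x).subst
      (MvPowerSeries.X i : MvPowerSeries (Fin (m + 1)) ℝ) := by
    rw [baseSeries, powSeries, ← Finset.prod_pow, ← Finset.prod_mul_distrib]
    refine Finset.prod_congr rfl fun i _ => ?_
    rw [PowerSeries.subst_mul (hasSubst_X i), PowerSeries.subst_pow (hasSubst_X i)]
  rw [h, coeff_prod_subst_X, Fin.prod_univ_succ, Fin.prod_univ_succ]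
  simp only [baseFactor, powFactor, Fin.cons_zero, Fin.cons_succ, one_mul]
  simp only [coeff_one_add_C_mul_X_pow, coeff_binomialSeries_mul_ratioSeries_pow hβ]
  rw [Finset.prod_div_distrib, Finset.prod_mul_distrib, Finset.prod_pow_eq_pow_sum, summand,
    descPochhammer_eval_natCast, weight]
  field_simp

theorem constantCoeff_subst_X {m : ℕ} (i : Fin m) (f : PowerSeries ℝ) :
    MvPowerSeries.constantCoeff (f.subst (MvPowerSeries.X i : MvPowerSeries (Fin m) ℝ)) =
      PowerSeries.constantCoeff f := by
  rw [← MvPowerSeries.coeff_zero_eq_constantCoeff_apply, PowerSeries.coeff_subst_single]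
  simp

theorem constantCoeff_powSeries (m : ℕ) (c : ℝ) :
    MvPowerSeries.constantCoeff (powSeries m c) = 1 := by
  rw [powSeries, map_prod]
  refine Finset.prod_eq_one fun i _ => ?_
  rw [constantCoeff_subst_X]
  refine Fin.cases ?_ (fun j => ?_) i <;> simp [powFactor, ratioSeries]

/-- A rigorous form of $\sum_x \frac{(\beta)_x}{x!}(cW)^x=(1-cW)^{-\beta}$: in a fixed coefficient
it is a finite combination of factorial moments. -/
theorem hasSum_weight_mul_coeff {β c : ℝ} (hc0 : 0 < c) (hc1 : c < 1) {m : ℕ}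
    (d : Fin (m + 1) →₀ ℕ) :
    HasSum (fun x => weight β c x * coeff d (baseSeries m β * powSeries m c ^ x))
      ((1 - c) ^ (-β) * coeff d (baseSeries m β *
        seriesPow (1 - MvPowerSeries.C (c / (1 - c)) * (powSeries m c - 1)) (-β))) := by
  have hc2 : 0 < 1 - c := by linarith
  have hcst := constantCoeff_powSeries m c
  -- The range of `k` depends on `d` only, not on `x`, so the sum over `x` can be taken term by
  -- term.
  have h1 : ∀ x : ℕ, coeff d (baseSeries m β * powSeries m c ^ x) =
      ∑ k ∈ Finset.range (d.degree + 1), (x.choose k : ℝ) *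
        coeff d (baseSeries m β * (powSeries m c - 1) ^ k) := by
    intro x
    rw [← seriesPow_natCast hcst, coeff_mul_seriesPow hcst]
    simp only [Ring.choose_natCast]
  have h2 := hasSum_sum (s := Finset.range (d.degree + 1)) fun k _ =>
    (hasSum_weight_mul_choose (β := β) hc0 hc1 k).mul_right
      (coeff d (baseSeries m β * (powSeries m c - 1) ^ k))
  have h5 : (1 - c) ^ (-β) * coeff d (baseSeries m β *
      seriesPow (1 - MvPowerSeries.C (c / (1 - c)) * (powSeries m c - 1)) (-β)) =
      ∑ k ∈ Finset.range (d.degree + 1), (ascPochhammer ℝ k).eval β / (k.factorial : ℝ) * c ^ k *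
        (1 - c) ^ (-β - k) * coeff d (baseSeries m β * (powSeries m c - 1) ^ k) := by
    rw [coeff_mul_seriesPow (by simp [hcst]), Finset.mul_sum]
    refine Finset.sum_congr rfl fun k _ => ?_
    have h3 : (1 - MvPowerSeries.C (c / (1 - c)) * (powSeries m c - 1) - 1) ^ k =
        MvPowerSeries.C ((-1) ^ k * (c / (1 - c)) ^ k) * (powSeries m c - 1) ^ k := by
      rw [map_mul, map_pow, map_pow, map_neg, map_one, ← mul_pow, ← mul_pow]
      ring
    have h4 : (-1 : ℝ) ^ k * (-1) ^ k = 1 := by rw [← mul_pow]; simp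
    rw [h3, mul_left_comm (baseSeries m β), MvPowerSeries.coeff_C_mul, choose_neg_eq_div, Real.rpow_sub hc2,
      Real.rpow_natCast, div_pow]
    field_simp
    linear_combination ((ascPochhammer ℝ k).eval β *
      coeff d (baseSeries m β * (powSeries m c - 1) ^ k)) * h4
  rw [h5]
  refine (congrArg (HasSum · _) (funext fun x => ?_)).mpr h2
  rw [h1, Finset.mul_sum]
  exact Finset.sum_congr rfl fun k _ => by ring

theorem subst_binomialSeries {m : ℕ} (i : Fin m) (r : ℝ) :
    (PowerSeries.binomialSeries ℝ r).subst (MvPowerSeries.X i : MvPowerSeries (Fin m) ℝ) =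
      seriesPow (1 + MvPowerSeries.X i) r := by
  rw [seriesPow, add_sub_cancel_left]

theorem baseSeries_eq (m : ℕ) (β : ℝ) :
    baseSeries m β = seriesPow (∏ j : Fin m, (1 + MvPowerSeries.X j.succ)) (-β) := by
  rw [baseSeries, seriesPow_prod _ (by simp), Fin.prod_univ_succ]
  simp only [baseFactor, Fin.cons_zero, Fin.cons_succ, subst_binomialSeries]
  rw [← PowerSeries.coe_substAlgHom (hasSubst_X _), map_one, one_mul]

theorem powSeries_mul (m : ℕ) (c : ℝ) :
    powSeries m c * ∏ j : Fin m, (1 + MvPowerSeries.X j.succ) =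
      (1 + MvPowerSeries.C ((1 - c) / c) * MvPowerSeries.X 0) *
        ∏ j : Fin m, (1 + MvPowerSeries.C (1 / c) * MvPowerSeries.X j.succ) := by
  have hlin : ∀ (i : Fin (m + 1)) (a : ℝ),
      (1 + PowerSeries.C a * PowerSeries.X : PowerSeries ℝ).subst
        (MvPowerSeries.X i : MvPowerSeries (Fin (m + 1)) ℝ) =
      1 + MvPowerSeries.C a * MvPowerSeries.X i := by
    intro i a
    rw [PowerSeries.subst_add (hasSubst_X i), PowerSeries.subst_mul (hasSubst_X i),
      PowerSeries.subst_X (hasSubst_X i), PowerSeries.subst_C,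
      ← PowerSeries.coe_substAlgHom (hasSubst_X i), map_one]
  rw [powSeries, Fin.prod_univ_succ, mul_assoc, ← Finset.prod_mul_distrib]
  simp only [powFactor, Fin.cons_zero, Fin.cons_succ, hlin]
  congr 1
  refine Finset.prod_congr rfl fun j _ => ?_
  rw [← hlin, ← ratioSeries_mul, PowerSeries.subst_mul (hasSubst_X _)]
  congr 1
  have := hlin j.succ 1
  simp only [map_one, one_mul] at this
  exact this.symm

theorem coe_bracket (m : ℕ) {c : ℝ} (hc0 : c ≠ 0) (hc1 : c ≠ 1) :
    (bracket m c : MvPowerSeries (Fin (m + 1)) ℝ) =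
      (∏ j : Fin m, (1 + MvPowerSeries.X j.succ)) *
        (1 - MvPowerSeries.C (c / (1 - c)) * (powSeries m c - 1)) := by
  have hc2 : 1 - c ≠ 0 := sub_ne_zero.mpr (Ne.symm hc1)
  have h := congrArg (MvPolynomial.coeToMvPowerSeries.ringHom (R := ℝ)) (C_mul_bracket m hc0 hc1)
  simp only [map_mul, map_sub, map_prod, map_add, map_one, one_mul,
    MvPolynomial.coeToMvPowerSeries.ringHom_apply, MvPolynomial.coe_C, MvPolynomial.coe_X] at h
  rw [← map_one MvPowerSeries.C, ← map_sub] at h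
  simp only [map_one] at h
  rw [← powSeries_mul] at h
  have h1 : (MvPowerSeries.C (1 - c)⁻¹ * MvPowerSeries.C (1 - c) :
      MvPowerSeries (Fin (m + 1)) ℝ) = 1 := by
    rw [← map_mul, inv_mul_cancel₀ hc2, map_one]
  have h2 : (MvPowerSeries.C (c / (1 - c)) : MvPowerSeries (Fin (m + 1)) ℝ) =
      MvPowerSeries.C (1 - c)⁻¹ * MvPowerSeries.C c := by
    rw [← map_mul]; congr 1; ring
  have h3 : (MvPowerSeries.C (1 - c) : MvPowerSeries (Fin (m + 1)) ℝ) =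
      1 - MvPowerSeries.C c := by simp
  rw [h2]
  set P : MvPowerSeries (Fin (m + 1)) ℝ := ∏ j : Fin m, (1 + MvPowerSeries.X j.succ)
  set I : MvPowerSeries (Fin (m + 1)) ℝ := MvPowerSeries.C (1 - c)⁻¹
  rw [h3] at h h1
  linear_combination I * h - ((bracket m c : MvPowerSeries (Fin (m + 1)) ℝ) - P) * h1

theorem seriesPow_bracket (m : ℕ) {c : ℝ} (hc0 : c ≠ 0) (hc1 : c ≠ 1) (β : ℝ) :
    seriesPow (bracket m c : MvPowerSeries (Fin (m + 1)) ℝ) (-β) = baseSeries m β *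
      seriesPow (1 - MvPowerSeries.C (c / (1 - c)) * (powSeries m c - 1)) (-β) := by
  rw [coe_bracket m hc0 hc1, seriesPow_mul (by simp [map_prod]) (by simp [constantCoeff_powSeries]),
    baseSeries_eq]

theorem hasSum_summand {m : ℕ} {β c : ℝ} (hβ : 0 < β) (hc0 : 0 < c) (hc1 : c < 1)
    (d : Fin (m + 1) →₀ ℕ) :
    HasSum (fun x => (-1) ^ (∑ j : Fin m, d j.succ) * ((1 - c) / c) ^ (d 0) *
        summand β c (d 0) (fun j : Fin m => d j.succ) x /
          ∏ i : Fin (m + 1), ((d i).factorial : ℝ))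
      ((1 - c) ^ (-β) *
        coeff d (seriesPow (bracket m c : MvPowerSeries (Fin (m + 1)) ℝ) (-β))) := by
  simp only [← coeff_baseSeries_mul_powSeries_pow hβ]
  rw [seriesPow_bracket m hc0.ne' hc1.ne]
  exact hasSum_weight_mul_coeff hc0 hc1 d

theorem summable_summand {m : ℕ} {β c : ℝ} (hβ : 0 < β) (hc0 : 0 < c) (hc1 : c < 1)
    (n₀ : ℕ) (n : Fin m → ℕ) : Summable (summand β c n₀ n) := by
  have h := (hasSum_summand hβ hc0 hc1
    (Finsupp.equivFunOnFinite.symm (Fin.cons n₀ n : Fin (m + 1) → ℕ))).summable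
  simp only [Finsupp.equivFunOnFinite_symm_apply_apply, Fin.cons_zero, Fin.cons_succ] at h
  have hc2 : 1 - c ≠ 0 := by linarith
  have hp : (∏ i, (((Fin.cons n₀ n : Fin (m + 1) → ℕ) i).factorial : ℝ)) ≠ 0 :=
    Finset.prod_ne_zero_iff.mpr fun i _ => by positivity
  simp only [div_eq_mul_inv (_ * _)] at h
  rw [summable_mul_right_iff (inv_ne_zero hp), summable_mul_left_iff (by positivity)] at h
  exact h

theorem genFun_eq (m : ℕ) {β c : ℝ} (hβ : 0 < β) (hc0 : 0 < c) (hc1 : c < 1) :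
    genFun m β c = seriesPow (bracket m c : MvPowerSeries (Fin (m + 1)) ℝ) (-β) := by
  have hc2 : 0 < 1 - c := by linarith
  ext d
  have h := (hasSum_summand hβ hc0 hc1 d).tsum_eq
  rw [tsum_div_const, tsum_mul_left] at h
  change B β c (d 0) (fun j : Fin m => d j.succ) / ∏ j : Fin (m + 1), ((d j).factorial : ℝ) = _
  have h1 : (1 - c) ^ β * (1 - c) ^ (-β) = 1 := by
    rw [← Real.rpow_add hc2]; simp
  calc _ = (1 - c) ^ β * ((1 - c) ^ (-β) *
        coeff d (seriesPow (bracket m c : MvPowerSeries (Fin (m + 1)) ℝ) (-β))) := by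
        rw [← h, B, Real.rpow_add hc2, Real.rpow_natCast, div_pow]
        ring
    _ = _ := by rw [← mul_assoc, h1, one_mul]

end Meixner

namespace Meixner

/-! ### Cycles, invariant colorings and signs -/

section Cycles

open Equiv.Perm

variable {α : Type*} [Fintype α] [DecidableEq α]

/-- The cycle of `a`, or `a` itself if it is fixed. -/
def cycleLabel (π : Equiv.Perm α) (a : α) : Equiv.Perm α ⊕ α :=
  if π a = a then Sum.inr a else Sum.inl (π.cycleOf a)

theorem cycleLabel_eq_iff (π : Equiv.Perm α) (a b : α) :
    cycleLabel π a = cycleLabel π b ↔ π.SameCycle a b := by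
  unfold cycleLabel
  split_ifs with ha hb hb
  · rw [Sum.inr.injEq]
    exact ⟨fun h => h ▸ SameCycle.refl _ _, fun h => h.eq_of_left ha⟩
  · simp only [false_iff]
    exact fun h => hb ((h.apply_eq_self_iff).mp ha)
  · simp only [false_iff]
    exact fun h => ha ((h.apply_eq_self_iff).mpr hb)
  · rw [Sum.inl.injEq, sameCycle_iff_cycleOf_eq_of_mem_support (mem_support.mpr ha)
      (mem_support.mpr hb)]

/-- The number of cycles is the number of classes of the relation of lying on the same cycle. -/
theorem card_range_cycleLabel (π : Equiv.Perm α) :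
    (Finset.univ.image (cycleLabel π)).card = cyc π := by
  have h : Finset.univ.image (cycleLabel π) =
      π.cycleFactorsFinset.disjSum (Finset.univ.filter fun a => π a = a) := by
    ext y
    simp only [Finset.mem_image, Finset.mem_univ, true_and]
    constructor
    · rintro ⟨a, rfl⟩
      unfold cycleLabel
      split_ifs with ha
      · simpa using ha
      · rw [Finset.inl_mem_disjSum, cycleOf_mem_cycleFactorsFinset_iff, mem_support]
        exact ha
    · rcases y with σ | a
      · rw [Finset.inl_mem_disjSum]
        intro hσ
        obtain ⟨a, ha⟩ := (mem_cycleFactorsFinset_iff.mp hσ).1.nonempty_support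
        refine ⟨a, ?_⟩
        have h1 : σ = π.cycleOf a := cycle_is_cycleOf ha hσ
        have h2 : π a ≠ a :=
          mem_support.mp (mem_cycleFactorsFinset_support_le hσ ha)
        rw [cycleLabel, if_neg h2, h1]
      · rw [Finset.inr_mem_disjSum]
        intro ha
        exact ⟨a, by rw [cycleLabel, if_pos (by simpa using ha)]⟩
  rw [h, Finset.card_disjSum, cyc, cycleType_def, Multiset.card_map]
  rfl

/-- The colorings that are constant on the cycles of `π`. -/
theorem card_invariant_colorings (π : Equiv.Perm α) (N : ℕ) :
    (Finset.univ.filter fun g : α → Fin N => ∀ a, g a = g (π a)).card = N ^ cyc π := by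
  rw [← card_range_cycleLabel, ← Fintype.card_subtype]
  set T := Finset.univ.image (cycleLabel π) with hT
  have hmem : ∀ a, cycleLabel π a ∈ T := fun a => Finset.mem_image_of_mem _ (Finset.mem_univ a)
  have hex : ∀ y : T, ∃ a, cycleLabel π a = y := fun y => by
    obtain ⟨a, _, ha⟩ := Finset.mem_image.mp y.2
    exact ⟨a, ha⟩
  choose rep hrep using hex
  have hstep : ∀ a, cycleLabel π a = cycleLabel π (π a) := fun a =>
    (cycleLabel_eq_iff π _ _).mpr ⟨1, by simp⟩
  have hinv : ∀ g : α → Fin N, (∀ a, g a = g (π a)) → ∀ a b, π.SameCycle a b → g a = g b := by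
    intro g hg a b hab
    obtain ⟨n, rfl⟩ := hab.exists_nat_pow_eq
    induction n with
    | zero => rfl
    | succ n ih =>
      rw [pow_succ', Equiv.Perm.mul_apply, ← hg]
      exact ih ⟨n, by simp⟩
  -- An invariant coloring is a free choice of a color for each cycle, read off at a representative.
  let e : {g : α → Fin N // ∀ a, g a = g (π a)} ≃ (T → Fin N) :=
    { toFun := fun g y => g.1 (rep y)
      invFun := fun h => ⟨fun a => h ⟨cycleLabel π a, hmem a⟩, fun a => by
        exact congrArg h (Subtype.ext (hstep a))⟩
      left_inv := fun g => by
        ext1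
        funext a
        exact hinv g.1 g.2 _ _ ((cycleLabel_eq_iff π _ _).mp (hrep ⟨cycleLabel π a, hmem a⟩))
      right_inv := fun h => by
        funext y
        exact congrArg h (Subtype.ext (hrep y)) }
  rw [Fintype.card_congr e]
  simp

theorem neg_one_pow_cyc (π : Equiv.Perm α) :
    (-1 : ℝ) ^ cyc π = (-1) ^ Fintype.card α * ((sign π : ℤ) : ℝ) := by
  have h1 : (Finset.univ.filter fun a => π a = a).card + π.support.card = Fintype.card α := by
    have := Finset.card_filter_add_card_filter_not (s := (Finset.univ : Finset α))
      (fun a => π a = a)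
    exact this
  have h2 : ((-1 : ℝ) ^ π.support.card) * (-1) ^ π.support.card = 1 := by
    rw [← mul_pow]; simp
  rw [sign_of_cycleType, sum_cycleType, ← h1, cyc]
  push_cast
  rw [pow_add, pow_add, pow_add]
  linear_combination (-((-1 : ℝ) ^ π.cycleType.card *
    (-1) ^ (Finset.univ.filter fun a => π a = a).card)) * h2

end Cycles

/-! ### Determinants constant off the diagonal -/

section Determinant

/-- Adding a multiple of the all-ones matrix changes the determinant affinely. -/
theorem exists_det_add_const {ι : Type*} [Fintype ι] [DecidableEq ι] (M : Matrix ι ι ℝ) (k : ι) :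
    ∃ b : ℝ, ∀ t : ℝ, (Matrix.of fun i j => M i j + t).det = M.det + t * b := by
  let N : Matrix ι ι ℝ := Matrix.of fun i j => M i j - M k j
  -- Subtracting row `k` from the other rows removes `t` from them; the determinant is then linear
  -- in row `k`, the only one still containing `t`.
  have key : ∀ t : ℝ, (Matrix.of fun i j => M i j + t).det =
      (N.updateRow k (M k)).det + t * (N.updateRow k 1).det := by
    intro t
    rw [← Matrix.det_updateRow_smul, ← Matrix.det_updateRow_add]
    refine Matrix.det_eq_of_forall_row_eq_smul_add_const (fun i => if i = k then 0 else 1) k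
      (by simp) fun i j => ?_
    by_cases hi : i = k
    · subst hi; simp
    · simp [hi, N]
      ring
  refine ⟨(N.updateRow k 1).det, fun t => ?_⟩
  have h0 := key 0
  simp only [add_zero, zero_mul] at h0
  rw [key, ← h0]
  rfl

/-- The determinant of a matrix that is constant above and below the diagonal. -/
theorem det_const_off_diagonal {ι κ : Type*} [Fintype ι] [DecidableEq ι] [LinearOrder κ]
    {f : ι → κ} (hf : Function.Injective f) (p q : ℝ) (r : ι → ℝ) :
    (q - p) * (Matrix.of fun i j => if f i < f j then p else if f j < f i then q else r i).det =
      q * ∏ i, (r i - p) - p * ∏ i, (r i - q) := by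
  rcases isEmpty_or_nonempty ι with h | ⟨⟨k⟩⟩
  · simp
  set M : Matrix ι ι ℝ :=
    Matrix.of fun i j => if f i < f j then p else if f j < f i then q else r i with hM
  obtain ⟨b, hb⟩ := exists_det_add_const M k
  -- Subtracting `p` or `q` from every entry makes the matrix triangular for the order pulled back
  -- along `f`. The two values of the affine function then determine its value at `t = 0`.
  let _ : LinearOrder ι := LinearOrder.lift' f hf
  have h1 : (Matrix.of fun i j => M i j + -p).det = ∏ i, (r i - p) := by
    rw [Matrix.det_of_isLowerTriangular]
    · refine Finset.prod_congr rfl fun i _ => ?_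
      simp [hM, sub_eq_add_neg]
    · intro i j hij
      have : f i < f j := hij
      simp [hM, this]
  have h2 : (Matrix.of fun i j => M i j + -q).det = ∏ i, (r i - q) := by
    rw [Matrix.det_of_isUpperTriangular]
    · refine Finset.prod_congr rfl fun i _ => ?_
      simp [hM, sub_eq_add_neg]
    · intro i j hij
      have : f j < f i := hij
      simp [hM, this, this.not_gt]
  rw [hb] at h1 h2
  linear_combination q * h1 - p * h2

end Determinant

/-! ### Iterated derivatives at the origin and the Leibniz rule -/

section Polarization

open MvPolynomial

theorem pderiv_prod {I K : Type*} [DecidableEq K] (i : I) (t : Finset K)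
    (F : K → MvPolynomial I ℝ) :
    pderiv i (∏ k ∈ t, F k) =
      ∑ k₀ ∈ t, ∏ k ∈ t, Function.update F k₀ (pderiv i (F k₀)) k := by
  induction t using Finset.induction_on with
  | empty => simp
  | insert a t ha ih =>
    rw [Finset.prod_insert ha, Derivation.leibniz, ih, Finset.sum_insert ha,
      Finset.prod_insert ha, Function.update_self, smul_eq_mul, smul_eq_mul, Finset.mul_sum]
    have h1 : ∏ k ∈ t, Function.update F a (pderiv i (F a)) k = ∏ k ∈ t, F k :=
      Finset.prod_congr rfl fun k hk => by
        rw [Function.update_of_ne (by rintro rfl; exact ha hk)]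
    have h2 : ∑ k₀ ∈ t, ∏ k ∈ insert a t, Function.update F k₀ (pderiv i (F k₀)) k =
        ∑ k₀ ∈ t, F a * ∏ k ∈ t, Function.update F k₀ (pderiv i (F k₀)) k :=
      Finset.sum_congr rfl fun k₀ hk₀ => by
        rw [Finset.prod_insert ha, Function.update_of_ne (by rintro rfl; exact ha hk₀)]
    rw [h1, h2]
    ring

/-- The values of `f` on the fiber of `g` over `k`. -/
def fiberValues {α I K : Type*} [Fintype α] [DecidableEq K] (f : α → I) (g : α → K) (k : K) :
    Multiset I :=
  (Finset.univ.filter fun a => g a = k).val.map f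

theorem fiberValues_cons {I K : Type*} [DecidableEq K] {n : ℕ} (f : Fin (n + 1) → I) (k₀ : K)
    (g : Fin n → K) (k : K) :
    fiberValues f (Fin.cons k₀ g : Fin (n + 1) → K) k =
      if k₀ = k then f 0 ::ₘ fiberValues (fun a => f a.succ) g k
      else fiberValues (fun a => f a.succ) g k := by
  have h : ((Finset.univ.filter fun a : Fin n => g a = k).map (Fin.succEmb n)).val.map f =
      fiberValues (fun a => f a.succ) g k := by
    rw [Finset.map_val, Multiset.map_map]
    rfl
  have h1 : (Finset.univ.filter fun a => (Fin.cons k₀ g : Fin (n + 1) → K) a = k) =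
      if k₀ = k then insert 0 ((Finset.univ.filter fun a => g a = k).map (Fin.succEmb n))
      else (Finset.univ.filter fun a => g a = k).map (Fin.succEmb n) := by
    ext a
    refine Fin.cases ?_ (fun a => ?_) a <;> split_ifs with hk <;> simp [hk]
  rw [fiberValues, h1, ← h]
  split_ifs
  · rw [Finset.insert_val_of_notMem (by simp), Multiset.map_cons]
  · rfl

variable {I : Type*} [Fintype I] [DecidableEq I]

/-- The iterated partial derivative of `F` along the variables in `s`, evaluated at `0`. -/
noncomputable def derivAtZero (s : Multiset I) (F : MvPolynomial I ℝ) : ℝ :=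
  (∏ i, ((s.count i).factorial : ℝ)) * coeff (Multiset.toFinsupp s) F

theorem derivAtZero_zero (F : MvPolynomial I ℝ) : derivAtZero 0 F = constantCoeff F := by
  simp [derivAtZero, constantCoeff_eq]

theorem derivAtZero_cons (i : I) (s : Multiset I) (F : MvPolynomial I ℝ) :
    derivAtZero (i ::ₘ s) F = derivAtZero s (pderiv i F) := by
  have h1 : (∏ j, (((i ::ₘ s).count j).factorial : ℝ)) =
      (s.count i + 1) * ∏ j, ((s.count j).factorial : ℝ) := by
    rw [← Finset.mul_prod_erase _ _ (Finset.mem_univ i),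
      ← Finset.mul_prod_erase (a := i) Finset.univ (fun j => ((s.count j).factorial : ℝ))
        (Finset.mem_univ i), Multiset.count_cons_self, Nat.factorial_succ, ← mul_assoc]
    push_cast
    congr 1
    refine Finset.prod_congr rfl fun j hj => ?_
    rw [Multiset.count_cons_of_ne (Finset.ne_of_mem_erase hj)]
  rw [derivAtZero, derivAtZero, coeff_pderiv, h1, Multiset.toFinsupp_apply,
    ← Multiset.singleton_add, Multiset.toFinsupp_add, Multiset.toFinsupp_singleton,
    add_comm (Finsupp.single i 1)]
  ring

theorem derivAtZero_sub (s : Multiset I) (F G : MvPolynomial I ℝ) :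
    derivAtZero s (F - G) = derivAtZero s F - derivAtZero s G := by
  simp [derivAtZero, mul_sub]

theorem derivAtZero_C_mul (s : Multiset I) (a : ℝ) (F : MvPolynomial I ℝ) :
    derivAtZero s (C a * F) = a * derivAtZero s F := by
  simp [derivAtZero, mul_left_comm]

theorem derivAtZero_sum {K : Type*} (s : Multiset I) (t : Finset K) (F : K → MvPolynomial I ℝ) :
    derivAtZero s (∑ k ∈ t, F k) = ∑ k ∈ t, derivAtZero s (F k) := by
  simp [derivAtZero, coeff_sum, Finset.mul_sum]

/-- The Leibniz rule for iterated derivatives of a product. -/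
theorem derivAtZero_prod_fin {K : Type*} [Fintype K] [DecidableEq K] {n : ℕ} (f : Fin n → I)
    (F : K → MvPolynomial I ℝ) :
    derivAtZero (Finset.univ.val.map f) (∏ k, F k) =
      ∑ g : Fin n → K, ∏ k, derivAtZero (fiberValues f g k) (F k) := by
  induction n generalizing F with
  | zero => simp [fiberValues, derivAtZero_zero, map_prod]
  | succ n ih =>
    have h0 : (Finset.univ : Finset (Fin (n + 1))).val.map f =
        f 0 ::ₘ (Finset.univ : Finset (Fin n)).val.map fun a => f a.succ := by
      simp [Fin.univ_succ, Function.comp_def]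
    rw [h0, derivAtZero_cons, pderiv_prod, derivAtZero_sum,
      ← (Fin.consEquiv fun _ : Fin (n + 1) => K).sum_comp, Fintype.sum_prod_type]
    refine Finset.sum_congr rfl fun k₀ _ => ?_
    rw [ih]
    refine Finset.sum_congr rfl fun g _ => Finset.prod_congr rfl fun k _ => ?_
    change _ = derivAtZero (fiberValues f (Fin.cons k₀ g : Fin (n + 1) → K) k) (F k)
    rw [fiberValues_cons]
    split_ifs with hk
    · subst hk
      rw [derivAtZero_cons, Function.update_self]
    · rw [Function.update_of_ne (Ne.symm hk)]

theorem derivAtZero_prod {α K : Type*} [Fintype α] [DecidableEq α] [Fintype K] [DecidableEq K] (f : α → I)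
    (F : K → MvPolynomial I ℝ) :
    derivAtZero (Finset.univ.val.map f) (∏ k, F k) =
      ∑ g : α → K, ∏ k, derivAtZero (fiberValues f g k) (F k) := by
  let e := Fintype.equivFin α
  have h0 : (Finset.univ : Finset α).val.map f =
      (Finset.univ : Finset (Fin (Fintype.card α))).val.map (f ∘ e.symm) := by
    rw [← Multiset.map_map, ← Finset.map_univ_equiv e.symm, Finset.map_val]
    rfl
  rw [h0, derivAtZero_prod_fin, ← (e.arrowCongr (Equiv.refl K)).sum_comp]
  refine Finset.sum_congr rfl fun g _ => Finset.prod_congr rfl fun k _ => ?_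
  congr 1
  have h1 : (Finset.univ.filter fun a => g a = k) =
      (Finset.univ.filter fun i => g (e.symm i) = k).map e.symm.toEmbedding := by
    ext a
    simp [Finset.mem_map_equiv]
  rw [fiberValues, fiberValues, h1, Finset.map_val, Multiset.map_map]
  rfl

/-- The product has degree at most one in each variable, so differentiating twice in a variable
gives zero. -/
theorem derivAtZero_prod_one_add (s : Multiset I) (u : I → ℝ) :
    derivAtZero s (∏ i, (1 + C (u i) * X i)) = if s.Nodup then (s.map u).prod else 0 := by
  have h1 : coeff (Multiset.toFinsupp s) (∏ i, (1 + C (u i) * X i)) =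
      ∏ i, ((Nat.choose 1 (s.count i) : ℝ) * u i ^ s.count i) := by
    rw [← coeff_coe]
    have h2 : ((∏ i, (1 + C (u i) * X i) : MvPolynomial I ℝ) : MvPowerSeries I ℝ) =
        ∏ i, (1 + PowerSeries.C (u i) * PowerSeries.X : PowerSeries ℝ).subst
          (MvPowerSeries.X i : MvPowerSeries I ℝ) := by
      rw [← coeToMvPowerSeries.ringHom_apply, map_prod]
      refine Finset.prod_congr rfl fun i _ => ?_
      have hs : PowerSeries.HasSubst (MvPowerSeries.X i : MvPowerSeries I ℝ) :=
        PowerSeries.HasSubst.X i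
      rw [PowerSeries.subst_add hs, PowerSeries.subst_mul hs, PowerSeries.subst_X hs,
        PowerSeries.subst_C, ← PowerSeries.coe_substAlgHom hs, map_one, map_add, map_mul, map_one]
      simp
    rw [h2, coeff_prod_subst_X]
    refine Finset.prod_congr rfl fun i _ => ?_
    rw [← coeff_one_add_C_mul_X_pow, pow_one, Multiset.toFinsupp_apply]
  rw [derivAtZero, h1, ← Finset.prod_mul_distrib]
  split_ifs with hs
  · rw [Finset.prod_multiset_map_count,
      Finset.prod_subset (Finset.subset_univ s.toFinset) fun i _ hi => ?_]
    · refine Finset.prod_congr rfl fun i _ => ?_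
      have := Multiset.nodup_iff_count_le_one.mp hs i
      interval_cases s.count i <;> simp
    · rw [Multiset.count_eq_zero_of_notMem (by simpa using hi), pow_zero]
  · rw [Multiset.nodup_iff_count_le_one] at hs
    push Not at hs
    obtain ⟨i, hi⟩ := hs
    refine Finset.prod_eq_zero (Finset.mem_univ i) ?_
    rw [Nat.choose_eq_zero_of_lt hi]
    simp

end Polarization

end Meixner

/-! ### Restricted permutations -/

namespace Meixner

/-- The weight of a step from box `i` to box `j`. -/
noncomputable def stepWeight {m : ℕ} (c : ℝ) (i j : Fin (m + 1)) : ℝ :=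
  if i < j then c⁻¹ else if j < i then 1 else if i = 0 then 1 else 0

theorem C_mul_bracket_eq_prod (m : ℕ) {c : ℝ} (hc0 : c ≠ 0) (hc1 : c ≠ 1) :
    MvPolynomial.C (1 - c) * bracket m c =
      ∏ i : Fin (m + 1), (1 + MvPolynomial.C (1 - if i = 0 then 1 else 0) * MvPolynomial.X i) -
        MvPolynomial.C c * ∏ i : Fin (m + 1),
          (1 + MvPolynomial.C (c⁻¹ - if i = 0 then 1 else 0) * MvPolynomial.X i) := by
  rw [C_mul_bracket m hc0 hc1, Fin.prod_univ_succ, Fin.prod_univ_succ]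
  have h : (1 - c) / c = c⁻¹ - 1 := by field_simp
  simp [Fin.succ_ne_zero, h]

/-- The derivatives of the bracket at `0` are determinants of step weights. -/
theorem derivAtZero_bracket {m : ℕ} {c : ℝ} (hc0 : c ≠ 0) (hc1 : c ≠ 1) {α : Type*} [Fintype α]
    [DecidableEq α] (f : α → Fin (m + 1)) :
    derivAtZero (Finset.univ.val.map f) (bracket m c) =
      (-1) ^ Fintype.card α * (Matrix.of fun a b => stepWeight c (f a) (f b)).det := by
  have hc2 : 1 - c ≠ 0 := sub_ne_zero.mpr (Ne.symm hc1)
  have h := congrArg (derivAtZero (Finset.univ.val.map f)) (C_mul_bracket_eq_prod m hc0 hc1)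
  rw [derivAtZero_C_mul, derivAtZero_sub, derivAtZero_C_mul, derivAtZero_prod_one_add,
    derivAtZero_prod_one_add] at h
  by_cases hf : Function.Injective f
  · have hn : (Finset.univ.val.map f).Nodup := Finset.univ.nodup.map hf
    rw [if_pos hn, if_pos hn, Multiset.map_map, Multiset.map_map] at h
    -- For injective `f` the diagonal entries are `1` in box `0` and `0` elsewhere; the two products
    -- in the closed form match those of `C_mul_bracket_eq_prod`.
    have hdet := det_const_off_diagonal hf c⁻¹ 1 fun a => if f a = 0 then 1 else 0
    have hneg : ∀ t : ℝ, ∏ a, ((if f a = 0 then 1 else 0) - t) =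
        (-1) ^ Fintype.card α * ∏ a, (t - if f a = 0 then 1 else 0) := by
      intro t
      rw [← Finset.card_univ, ← Finset.prod_const, ← Finset.prod_mul_distrib]
      exact Finset.prod_congr rfl fun a _ => by ring
    rw [hneg, hneg] at hdet
    change _ = ∏ a, (1 - if f a = 0 then 1 else 0) -
      c * ∏ a, (c⁻¹ - if f a = 0 then (1 : ℝ) else 0) at h
    change (1 - c⁻¹) * (Matrix.of fun a b => stepWeight c (f a) (f b)).det = _ at hdet
    have h1 : ((-1 : ℝ) ^ Fintype.card α) * (-1) ^ Fintype.card α = 1 := by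
      rw [← mul_pow]; simp
    have h2 : c * c⁻¹ = 1 := mul_inv_cancel₀ hc0
    apply mul_left_cancel₀ hc2
    set P : ℝ := ∏ a, (1 - if f a = 0 then 1 else 0)
    set Q : ℝ := ∏ a, (c⁻¹ - if f a = 0 then (1 : ℝ) else 0)
    set s : ℝ := (-1) ^ Fintype.card α
    set D := (Matrix.of fun a b => stepWeight c (f a) (f b)).det
    linear_combination h + c * s * hdet + (c * Q - P) * h1 + (s * D - s * s * P) * h2
  -- A repeated box kills the derivative, the bracket being affine in each variable, and gives the
  -- matrix two equal rows.
  · have hn : ¬ (Finset.univ.val.map f).Nodup := fun hn => hf fun a b hab =>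
      Multiset.inj_on_of_nodup_map hn a (Finset.mem_univ a) b (Finset.mem_univ b) hab
    rw [if_neg hn, if_neg hn] at h
    have h0 : derivAtZero (Finset.univ.val.map f) (bracket m c) = 0 := by
      apply mul_left_cancel₀ hc2
      linear_combination h
    rw [h0]
    simp only [Function.Injective, not_forall] at hf
    obtain ⟨a, b, hab, hne⟩ := hf
    rw [Matrix.det_zero_of_row_eq hne (by funext j; simp [hab]), mul_zero]

theorem fiberValues_eq_map_subtype {α I K : Type*} [Fintype α] [DecidableEq K] (f : α → I)
    (g : α → K) (k : K) :
    fiberValues f g k = (Finset.univ : Finset {a // g a = k}).val.map (f ∘ Subtype.val) := by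
  have h : (Finset.univ.filter fun a => g a = k) =
      (Finset.univ : Finset {a // g a = k}).map (Function.Embedding.subtype _) := by
    ext a; simp
  rw [fiberValues, h, Finset.map_val, Multiset.map_map]
  rfl

/-- The cycle generating polynomial of the step weights at a nonpositive integer. -/
theorem sum_neg_natCast_pow_cyc {m : ℕ} {c : ℝ} (hc0 : c ≠ 0) (hc1 : c ≠ 1) {α : Type*}
    [Fintype α] [DecidableEq α] (f : α → Fin (m + 1)) (N : ℕ) :
    ∑ π : Equiv.Perm α, (-(N : ℝ)) ^ cyc π * ∏ a, stepWeight c (f a) (f (π a)) =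
      derivAtZero (Finset.univ.val.map f) (bracket m c ^ N) := by
  -- For a fixed coloring, zeroing the entries between different colors makes the matrix block
  -- diagonal, and its determinant expansion keeps just the permutations that preserve colors.
  have hM : ∀ g : α → Fin N,
      (∑ π : Equiv.Perm α, (-1 : ℝ) ^ Fintype.card α * ((Equiv.Perm.sign π : ℤ) : ℝ) *
        if ∀ a, g a = g (π a) then ∏ a, stepWeight c (f a) (f (π a)) else 0) =
      ∏ k, derivAtZero (fiberValues f g k) (bracket m c) := by
    intro g
    set M : Matrix α α ℝ :=
      Matrix.of fun a b => if g a = g b then stepWeight c (f a) (f b) else 0 with hMdef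
    have hdet : M.det = ∏ k, (M.toSquareBlock g k).det :=
      Matrix.BlockTriangular.det_fintype fun a b hab => by simp [hMdef, hab.ne']
    have hcard : ∑ k, Fintype.card {a // g a = k} = Fintype.card α := by
      rw [← Fintype.card_sigma]
      exact Fintype.card_congr (Equiv.sigmaFiberEquiv g)
    calc _ = (-1 : ℝ) ^ Fintype.card α * M.det := by
          rw [← Matrix.det_transpose, Matrix.det_apply', Finset.mul_sum]
          refine Finset.sum_congr rfl fun π _ => ?_
          rw [mul_assoc, ← Fintype.prod_ite_zero]
          rfl
      _ = ∏ k, ((-1 : ℝ) ^ Fintype.card {a // g a = k} * (M.toSquareBlock g k).det) := by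
          rw [Finset.prod_mul_distrib, Finset.prod_pow_eq_pow_sum, hcard, hdet]
      _ = _ := by
          refine Finset.prod_congr rfl fun k _ => ?_
          rw [fiberValues_eq_map_subtype, derivAtZero_bracket hc0 hc1]
          congr 2
          ext a b
          simp [Matrix.toSquareBlock_def, hMdef, a.2, b.2]
  have hN : bracket m c ^ N = ∏ _k : Fin N, bracket m c := by simp
  rw [hN, derivAtZero_prod, ← Finset.sum_congr rfl fun g _ => hM g, Finset.sum_comm]
  refine Finset.sum_congr rfl fun π _ => ?_
  rw [← Finset.mul_sum, ← Finset.sum_filter, Finset.sum_const, card_invariant_colorings,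
    ← neg_one_pow_cyc, nsmul_eq_mul, neg_pow]
  push_cast
  ring

/-- Both sides are polynomials in `β`, and they agree at `β = -N`, where the real power of the
bracket is its ordinary `N`-th power. -/
theorem sum_pow_cyc {m : ℕ} {c : ℝ} (hc0 : c ≠ 0) (hc1 : c ≠ 1) {α : Type*}
    [Fintype α] [DecidableEq α] (f : α → Fin (m + 1)) (β : ℝ) :
    ∑ π : Equiv.Perm α, β ^ cyc π * ∏ a, stepWeight c (f a) (f (π a)) =
      (∏ i, (((Finset.univ.val.map f).count i).factorial : ℝ)) *
        MvPowerSeries.coeff (Multiset.toFinsupp (Finset.univ.val.map f))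
          (seriesPow (bracket m c : MvPowerSeries (Fin (m + 1)) ℝ) (-β)) := by
  set s := (Finset.univ : Finset α).val.map f
  have hcst : MvPowerSeries.constantCoeff (bracket m c : MvPowerSeries (Fin (m + 1)) ℝ) = 1 := by
    rw [coe_bracket m hc0 hc1]
    simp [map_prod, constantCoeff_powSeries]
  obtain ⟨p, hp⟩ := isPolyFamily_seriesPow hcst (Multiset.toFinsupp s)
  have key : (∑ π : Equiv.Perm α, Polynomial.C (∏ a, stepWeight c (f a) (f (π a))) *
      (-Polynomial.X) ^ cyc π : Polynomial ℝ) =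
      Polynomial.C (∏ i, ((s.count i).factorial : ℝ)) * p := by
    refine polynomial_eq_of_eval_natCast fun N => ?_
    rw [Polynomial.eval_mul, Polynomial.eval_C, hp, seriesPow_natCast hcst, ← MvPolynomial.coe_pow,
      MvPolynomial.coeff_coe, ← derivAtZero, ← sum_neg_natCast_pow_cyc hc0 hc1 f N,
      Polynomial.eval_finsetSum]
    refine Finset.sum_congr rfl fun π _ => ?_
    rw [Polynomial.eval_mul, Polynomial.eval_C]
    simp [mul_comm]
  have h := congrArg (Polynomial.eval (-β)) key
  rw [Polynomial.eval_mul, Polynomial.eval_C, hp, Polynomial.eval_finsetSum] at h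
  rw [← h]
  refine Finset.sum_congr rfl fun π _ => ?_
  rw [Polynomial.eval_mul, Polynomial.eval_C]
  simp [mul_comm]

/-- Each box-excedance contributes `c⁻¹`; a step that stays in a box other than box `0` has weight
zero, which enforces the restriction. -/
theorem prod_stepWeight {m : ℕ} (c : ℝ) {n₀ : ℕ} {n : Fin m → ℕ}
    (π : Equiv.Perm (Obj n₀ n)) :
    ∏ a, stepWeight c a.1 (π a).1 = if π ∈ starPerms n₀ n then (c ^ exc π)⁻¹ else 0 := by
  split_ifs with hπ
  · have hπ' : ∀ a : Obj n₀ n, a.1 ≠ 0 → (π a).1 ≠ a.1 := by simpa [starPerms] using hπ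
    rw [exc, ← inv_pow, ← Finset.prod_const, Finset.prod_filter]
    refine Finset.prod_congr rfl fun a _ => ?_
    unfold stepWeight
    split_ifs with h1 h2 h3
    · rfl
    · rfl
    · rfl
    · exact absurd (le_antisymm (not_lt.mp h1) (not_lt.mp h2)) (hπ' a h3)
  · have hex : ∃ a : Obj n₀ n, a.1 ≠ 0 ∧ (π a).1 = a.1 := by
      by_contra h
      push Not at h
      exact hπ (by simpa [starPerms] using h)
    obtain ⟨a, h0, ha⟩ := hex
    refine Finset.prod_eq_zero (Finset.mem_univ a) ?_
    simp [stepWeight, ha, h0]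

theorem count_box {m : ℕ} (n₀ : ℕ) (n : Fin m → ℕ) (i : Fin (m + 1)) :
    ((Finset.univ : Finset (Obj n₀ n)).val.map Sigma.fst).count i =
      (Fin.cons n₀ n : Fin (m + 1) → ℕ) i := by
  classical
  rw [Multiset.count_map, ← Finset.filter_val, Finset.card_val, ← Fintype.card_subtype]
  have e : {a : Obj n₀ n // i = a.1} ≃ Fin ((Fin.cons n₀ n : Fin (m + 1) → ℕ) i) :=
    (Equiv.subtypeEquivRight fun a => eq_comm).trans (Equiv.sigmaSubtype i)
  rw [Fintype.card_congr e, Fintype.card_fin]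

/-- `B` counts the restricted permutations of the boxes by cycles and box-excedances. -/
theorem B_eq_sum_starPerms {m : ℕ} {β c : ℝ} (hβ : 0 < β) (hc0 : 0 < c) (hc1 : c < 1) (n₀ : ℕ)
    (n : Fin m → ℕ) :
    B β c n₀ n = ∑ π ∈ starPerms n₀ n, β ^ cyc π * (c ^ exc π)⁻¹ := by
  have h := sum_pow_cyc hc0.ne' hc1.ne (fun a : Obj n₀ n => a.1) β
  have hd : Multiset.toFinsupp ((Finset.univ : Finset (Obj n₀ n)).val.map Sigma.fst) =
      Finsupp.equivFunOnFinite.symm (Fin.cons n₀ n : Fin (m + 1) → ℕ) := by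
    ext i
    rw [Multiset.toFinsupp_apply, count_box]
    rfl
  rw [hd, ← genFun_eq m hβ hc0 hc1] at h
  simp only [count_box, prod_stepWeight, mul_ite, mul_zero] at h
  rw [← Finset.sum_filter, Finset.filter_mem_eq_inter, Finset.univ_inter] at h
  rw [h]
  change _ = _ * (B β c n₀ n / ∏ i : Fin (m + 1),
    (((Fin.cons n₀ n : Fin (m + 1) → ℕ) i).factorial : ℝ))
  rw [mul_div_cancel₀]
  exact Finset.prod_ne_zero_iff.mpr fun i _ => by positivity

end Meixner

theorem mainTheorem9 (m : ℕ) (β c : ℝ) (hβ : 0 < β) (hc0 : 0 < c) (hc1 : c < 1) :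
    (∀ (n₀ : ℕ) (n : Fin m → ℕ), Summable (Meixner.summand β c n₀ n)) ∧
    Meixner.genFun m β c =
      Meixner.seriesPow (Meixner.bracket m c : MvPowerSeries (Fin (m + 1)) ℝ) (-β) ∧
    ∀ (n₀ : ℕ) (n : Fin m → ℕ),
      Meixner.B β c n₀ n =
        ∑ π ∈ Meixner.starPerms n₀ n, β ^ Meixner.cyc π * (c ^ Meixner.exc π)⁻¹ :=
  ⟨Meixner.summable_summand hβ hc0 hc1, Meixner.genFun_eq m hβ hc0 hc1,
    Meixner.B_eq_sum_starPerms hβ hc0 hc1⟩
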